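/- Let $V$ be a 3-dimensional handlebody of genus $g$, let $D\subset\partial V$ be a closed disk, let $\Sigma=\partial V\setminus\operatorname{int}(D)$ and $\star\in\partial\Sigma$. Put $\pi=\pi_1(\Sigma,\star)$ and $F=\pi_1(V,\star)$, let $\varpi:\pi\to F$ be induced by the inclusion, and let $\zeta=[\partial\Sigma]\in\pi$. Fix a system of meridians and parallels $(\alpha_1,\dots,\alpha_g,\beta_1,\dots,\beta_g)$, that is, a basis of the free group $\pi$ such that $\ker\varpi$ is the normal closure of $\alpha_1,\dots,\alpha_g$ and $\zeta^{-1}=\prod_{i=1}^g[\beta_i^{-1},\alpha_i]$, where $[x,y]=xyx^{-1}y^{-1}$. Let $\mathcal H$ be the handlebody group, i.e. the mapping class group of $V$ rel $D$, which acts on $\pi$ and on $F$; write $h^F\in\operatorname{Aut}(F)$ for the action of $h\in\mathcal H$ on $F$. Let $\mathcal T=\{f\in\mathcal H: f^F=\mathrm{id}_F\}$ be the twist group. Let $\frac{\partial}{\partial\alpha_i},\frac{\partial}{\partial\beta_i}:\mathbb Z[\pi]\to\mathbb Z[\pi]$ be the left Fox derivatives for the basis $(\alpha,\beta)$, so that $w-1=\sum_i\frac{\partial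 w}{\partial\alpha_i}(\alpha_i-1)+\sum_i\frac{\partial w}{\partial\beta_i}(\beta_i-1)$ for $w\in\pi$. Let $u\mapsto\overline u$ be the linear extension of inversion on a group ring, extend $\varpi$ and $h^F$ linearly to group rings, and let $M^\dagger=(\overline{m_{ji}})_{i,j}$ be the conjugate transpose of $M=(m_{ij})_{i,j}\in\operatorname{Mat}(g\times g;\mathbb Z[F])$. Define $$\operatorname{Mag}(f)=\Big(\varpi\Big(\overline{\tfrac{\partial f(\beta_j)}{\partial\alpha_i}}\Big)\Big)_{i,j}\ (f\in\mathcal T),\qquad \operatorname{Mag}_0^1(h)=\Big(\varpi\Big(\overline{\tfrac{\partial h(\alpha_j)}{\partial\alpha_i}}\Big)\Big)_{i,j}\ (h\in\mathcal H).$$ Then the Magnus representation $\operatorname{Mag}:\mathcal T\to\operatorname{Mat}(g\times g;\mathbb Z[F])$ takes values in hermitian matrices: $\operatorname{Mag}(f)=\operatorname{Mag}(f)^\dagger$ for all $f\in\mathcal T$. Besides, for all $f\in\mathcal T$ and $h\in\mathcal H$, $$\operatorname{Mag}(hfh^{-1})=\operatorname{Mag}_0^1(h)\cdot h^F\big(\operatorname{Mag}(f)\big)\cdot\operatorname{Mag}_0^1(h)^\dagger,$$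 where $h^F$ is applied to each matrix entry. -/

import Mathlib

open Matrix unitInterval

/-! ### Fundamental groups

Mathlib multiplies loops in the order of composition of arrows, `p * q = q.trans p`. We pass to the
opposite group, so that a product of loops runs through the left factor first. -/

/-- The fundamental group, with the product given by concatenation of loops (left factor first). -/
abbrev Pi1 (X : Type*) [TopologicalSpace X] (x : X) : Type _ := (FundamentalGroup X x)ᵐᵒᵖ

namespace Pi1

variable {X Y : Type*} [TopologicalSpace X] [TopologicalSpace Y]

/-- The class of a loop. -/
def mk {x : X} (p : Path x x) : Pi1 X x :=
  MulOpposite.op (FundamentalGroup.fromPath (Path.Homotopic.Quotient.mk p))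

theorem mk_trans {x : X} (p q : Path x x) : mk (p.trans q) = mk p * mk q := rfl

theorem mk_surjective {x : X} (a : Pi1 X x) : ∃ p : Path x x, mk p = a := by
  obtain ⟨p, hp⟩ := Path.Homotopic.Quotient.mk_surjective (MulOpposite.unop a)
  exact ⟨p, congrArg MulOpposite.op hp⟩

theorem mk_eq {x : X} {p q : Path x x} (h : p.Homotopic q) : mk p = mk q :=
  congrArg MulOpposite.op (Path.Homotopic.Quotient.eq.2 h)

/-- The homomorphism of fundamental groups induced by a based continuous map. -/
noncomputable def map (f : C(X, Y)) {x : X} {y : Y} (h : f x = y) : Pi1 X x →* Pi1 Y y :=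
  MonoidHom.op (FundamentalGroup.mapOfEq f h)

theorem map_mk (f : C(X, Y)) {x : X} {y : Y} (h : f x = y) (p : Path x x) :
    map f h (mk p) = mk ((p.map f.continuous).cast h.symm h.symm) :=
  congrArg MulOpposite.op (FundamentalGroup.mapOfEq_apply f h _)

end Pi1

/-- The homeomorphisms of `X` that fix the point `x`. -/
def basedHomeo (X : Type*) [TopologicalSpace X] (x : X) : Subgroup (X ≃ₜ X) where
  carrier := {h | h x = x}
  mul_mem' {a b} ha hb := by
    change a (b x) = x
    rw [show b x = x from hb, show a x = x from ha]
  one_mem' := rfl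
  inv_mem' {a} ha := by
    change a.symm x = x
    rw [Homeomorph.symm_apply_eq]
    exact (show a x = x from ha).symm

section BasedAction

variable {X : Type*} [TopologicalSpace X] (x : X)

/-- The endomorphism of the fundamental group induced by a based homeomorphism. -/
noncomputable def basedHomeoEnd (h : basedHomeo X x) : Pi1 X x →* Pi1 X x :=
  Pi1.map (h.1 : C(X, X)) h.2

theorem basedHomeoEnd_mk (h : basedHomeo X x) (p : Path x x) :
    basedHomeoEnd x h (Pi1.mk p) = Pi1.mk ((p.map h.1.continuous).cast h.2.symm h.2.symm) :=
  Pi1.map_mk _ _ p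

theorem basedHomeoEnd_one (a : Pi1 X x) : basedHomeoEnd x 1 a = a := by
  obtain ⟨p, rfl⟩ := Pi1.mk_surjective a
  rw [basedHomeoEnd_mk]
  rfl

theorem basedHomeoEnd_mul (h k : basedHomeo X x) (a : Pi1 X x) :
    basedHomeoEnd x (h * k) a = basedHomeoEnd x h (basedHomeoEnd x k a) := by
  obtain ⟨p, rfl⟩ := Pi1.mk_surjective a
  rw [basedHomeoEnd_mk, basedHomeoEnd_mk, basedHomeoEnd_mk]
  rfl

/-- The action of the based homeomorphisms on the fundamental group. -/
noncomputable def pi1Action : basedHomeo X x →* MulAut (Pi1 X x) where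
  toFun h :=
    { basedHomeoEnd x h with
      invFun := basedHomeoEnd x h⁻¹
      left_inv := fun a => by
        change basedHomeoEnd x h⁻¹ (basedHomeoEnd x h a) = a
        rw [← basedHomeoEnd_mul, inv_mul_cancel, basedHomeoEnd_one]
      right_inv := fun a => by
        change basedHomeoEnd x h (basedHomeoEnd x h⁻¹ a) = a
        rw [← basedHomeoEnd_mul, mul_inv_cancel, basedHomeoEnd_one] }
  map_one' := MulEquiv.ext fun a => basedHomeoEnd_one x a
  map_mul' h k := MulEquiv.ext fun a => basedHomeoEnd_mul x h k a

theorem pi1Action_apply (h : basedHomeo X x) (a : Pi1 X x) :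
    pi1Action x h a = basedHomeoEnd x h a := rfl

/-- A homeomorphism that is homotopic to the identity relative to the base point acts trivially. -/
theorem pi1Action_eq_one_of_homotopy (h : basedHomeo X x) (H : C(I × X, X))
    (h0 : ∀ y, H (0, y) = y) (h1 : ∀ y, H (1, y) = h.1 y) (hx : ∀ t, H (t, x) = x) :
    pi1Action x h = 1 := by
  refine MulEquiv.ext fun a => ?_
  obtain ⟨p, rfl⟩ := Pi1.mk_surjective a
  rw [pi1Action_apply, basedHomeoEnd_mk]
  refine (Pi1.mk_eq ⟨?_⟩).symm
  refine
    { toFun := fun q => H (q.1, p q.2)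
      continuous_toFun := by fun_prop
      map_zero_left := fun s => h0 _
      map_one_left := fun s => h1 _
      prop' := fun t s hs => ?_ }
  rcases hs with rfl | rfl
  · simp [hx]
  · simp [hx]

end BasedAction

/-! ### Handlebodies -/

/-- The standard handlebody of genus `g` in `ℝ³`: the product of a closed disk with `g` holes
(round open disks centred at `(0,0), …, (g-1,0)`) and the interval `[0,1]`. -/
def handlebodyModel (g : ℕ) : Set (EuclideanSpace ℝ (Fin 3)) :=
  {v | v 0 ^ 2 + v 1 ^ 2 ≤ ((g : ℝ) + 1) ^ 2 ∧
    (∀ i : Fin g, (1 / 3 : ℝ) ^ 2 ≤ (v 0 - (i : ℝ)) ^ 2 + v 1 ^ 2) ∧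
    0 ≤ v 2 ∧ v 2 ≤ 1}

/-- A handlebody of genus `g` is a space homeomorphic to the standard one. -/
def IsHandlebody (g : ℕ) (V : Type*) [TopologicalSpace V] : Prop :=
  Nonempty (V ≃ₜ handlebodyModel g)

/-- The boundary `∂V` of a `3`-manifold `V`: the points without an open neighbourhood that is
homeomorphic to `ℝ³`. -/
def boundary3 (V : Type*) [TopologicalSpace V] : Set V :=
  {x | ¬ ∃ U : Set V, IsOpen U ∧ x ∈ U ∧ Nonempty (U ≃ₜ EuclideanSpace ℝ (Fin 3))}

theorem boundary3_of_homeo {V : Type*} [TopologicalSpace V] (h : V ≃ₜ V) {x : V}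
    (hx : x ∈ boundary3 V) : h x ∈ boundary3 V := by
  rintro ⟨U, hU, hxU, ⟨e⟩⟩
  exact hx ⟨h ⁻¹' U, hU.preimage h.continuous, hxU,
    ⟨(h.sets (s := h ⁻¹' U) (t := U) rfl).trans e⟩⟩

/-- The closed unit disk in `ℂ`. -/
abbrev UnitDisk : Type := Metric.closedBall (0 : ℂ) 1

/-- The point `z` of the unit circle, as a point of the unit disk. -/
def circlePoint (z : Circle) : UnitDisk := ⟨(z : ℂ), by
  rw [mem_closedBall_zero_iff, Circle.norm_coe]⟩

/-- A (parametrized) closed disk `D` embedded in the boundary of `V`. As `UnitDisk` is compact, a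
continuous injective map to a Hausdorff space is an embedding. -/
structure BoundaryDisk (V : Type*) [TopologicalSpace V] where
  /-- the parametrization of the disk -/
  param : C(UnitDisk, V)
  injective : Function.Injective param
  mem_boundary : ∀ z, param z ∈ boundary3 V

namespace BoundaryDisk

variable {V : Type*} [TopologicalSpace V] (D : BoundaryDisk V)

/-- The surface `Σ = ∂V ∖ int(D)`. -/
def surface : Set V := boundary3 V \ (D.param '' {z | ‖(z : ℂ)‖ < 1})

theorem circle_mem_surface (z : Circle) : D.param (circlePoint z) ∈ D.surface := by
  refine ⟨D.mem_boundary _, ?_⟩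
  rintro ⟨w, hw, hwz⟩
  rw [D.injective hwz] at hw
  exact (lt_irrefl (1 : ℝ)) ((Circle.norm_coe z).symm.trans_lt hw)

/-- The base point `⋆ ∈ ∂Σ = ∂D`, as a point of `Σ`. -/
noncomputable def base : D.surface := ⟨D.param (circlePoint 1), D.circle_mem_surface 1⟩

/-- The boundary loop of `Σ`, which runs once along `∂D`. -/
noncomputable def boundaryLoop : Path D.base D.base where
  toFun t := ⟨D.param (circlePoint (Circle.exp (2 * Real.pi * t))), D.circle_mem_surface _⟩
  continuous_toFun := by
    refine Continuous.subtype_mk (D.param.continuous.comp (Continuous.subtype_mk ?_ _)) _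
    fun_prop
  source' := by simp [base]
  target' := by simp [base]

/-- The group `π = π₁(Σ,⋆)`. -/
abbrev surfaceGroup : Type _ := Pi1 D.surface D.base

/-- The group `F = π₁(V,⋆)`. -/
abbrev bodyGroup : Type _ := Pi1 V (D.base : V)

/-- The class `ζ = [∂Σ] ∈ π`. -/
noncomputable def zeta : D.surfaceGroup := Pi1.mk D.boundaryLoop

/-- The homomorphism `ϖ : π → F` induced by the inclusion of `Σ` in `V`. -/
noncomputable def proj : D.surfaceGroup →* D.bodyGroup :=
  Pi1.map ⟨Subtype.val, continuous_subtype_val⟩ rfl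

/-! ### The handlebody group -/

/-- The group of the self-homeomorphisms of `V` that fix `D` pointwise. -/
def relHomeo : Subgroup (V ≃ₜ V) where
  carrier := {h | ∀ z, h (D.param z) = D.param z}
  mul_mem' {a b} ha hb z := by
    change a (b (D.param z)) = D.param z
    rw [hb z, ha z]
  one_mem' _ := rfl
  inv_mem' {a} ha z := by
    change a.symm (D.param z) = D.param z
    rw [Homeomorph.symm_apply_eq]
    exact (ha z).symm

/-- `Φ` is an isotopy relative to `D` from the identity to `h`: a level-preserving homeomorphism of
`[0,1] × V` that fixes `[0,1] × D` pointwise, is the identity on level `0` and `h` on level `1`. -/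
structure IsIsotopy (Φ : (I × V) ≃ₜ (I × V)) (h : V ≃ₜ V) : Prop where
  level : ∀ q, (Φ q).1 = q.1
  fix : ∀ t z, Φ (t, D.param z) = (t, D.param z)
  zero : ∀ x, Φ (0, x) = (0, x)
  one : ∀ x, Φ (1, x) = (1, h x)

/-- The subgroup of the homeomorphisms isotopic to the identity relative to `D`. -/
def isotopicToId : Subgroup D.relHomeo where
  carrier := {h | ∃ Φ, D.IsIsotopy Φ h.1}
  mul_mem' := by
    rintro a b ⟨Φ, hΦ⟩ ⟨Ψ, hΨ⟩
    refine ⟨Φ * Ψ, ⟨fun q => ?_, fun t z => ?_, fun x => ?_, fun x => ?_⟩⟩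
    · rw [Homeomorph.mul_apply, hΦ.level, hΨ.level]
    · rw [Homeomorph.mul_apply, hΨ.fix, hΦ.fix]
    · rw [Homeomorph.mul_apply, hΨ.zero, hΦ.zero]
    · rw [Homeomorph.mul_apply, hΨ.one, hΦ.one]
      rfl
  one_mem' := ⟨1, ⟨fun _ => rfl, fun _ _ => rfl, fun _ => rfl, fun _ => rfl⟩⟩
  inv_mem' := by
    rintro a ⟨Φ, hΦ⟩
    refine ⟨Φ⁻¹, ⟨fun q => ?_, fun t z => ?_, fun x => ?_, fun x => ?_⟩⟩
    · have := hΦ.level (Φ.symm q)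
      rw [Homeomorph.apply_symm_apply] at this
      exact this.symm
    · exact (Homeomorph.symm_apply_eq _).2 (hΦ.fix t z).symm
    · exact (Homeomorph.symm_apply_eq _).2 (hΦ.zero x).symm
    · refine (Homeomorph.symm_apply_eq _).2 ?_
      rw [hΦ.one]
      exact congrArg (Prod.mk 1) (a.1.apply_symm_apply x).symm

instance isotopicToId_normal : D.isotopicToId.Normal where
  conj_mem := by
    rintro n ⟨Φ, hΦ⟩ k
    have hk : ∀ z, k.1.symm (D.param z) = D.param z := (k⁻¹).2
    let K : (I × V) ≃ₜ (I × V) := (Homeomorph.refl I).prodCongr k.1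
    have hK : ∀ t x, K (t, x) = (t, k.1 x) := fun _ _ => rfl
    have hK' : ∀ t x, K⁻¹ (t, x) = (t, k.1.symm x) := fun _ _ => rfl
    have hlev : ∀ t x, Φ (t, x) = (t, (Φ (t, x)).2) := fun t x =>
      Prod.ext (hΦ.level _) rfl
    refine ⟨K * Φ * K⁻¹, ⟨fun q => ?_, fun t z => ?_, fun x => ?_, fun x => ?_⟩⟩
    · obtain ⟨t, x⟩ := q
      rw [Homeomorph.mul_apply, Homeomorph.mul_apply, hK', hlev, hK]
    · rw [Homeomorph.mul_apply, Homeomorph.mul_apply, hK', hk, hΦ.fix, hK]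
      exact congrArg (Prod.mk t) (k.2 z)
    · rw [Homeomorph.mul_apply, Homeomorph.mul_apply, hK', hΦ.zero, hK]
      exact congrArg (Prod.mk 0) (k.1.apply_symm_apply x)
    · rw [Homeomorph.mul_apply, Homeomorph.mul_apply, hK', hΦ.one, hK]
      rfl

/-- The handlebody group `ℋ`: the mapping class group of `V` relative to `D`. -/
abbrev HandlebodyGroup : Type _ := D.relHomeo ⧸ D.isotopicToId

theorem relHomeo_mem_surface (h : D.relHomeo) {x : V} (hx : x ∈ D.surface) :
    h.1 x ∈ D.surface := by
  refine ⟨boundary3_of_homeo h.1 hx.1, ?_⟩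
  rintro ⟨z, hz, hzx⟩
  exact hx.2 ⟨z, hz, h.1.injective ((h.2 z).trans hzx)⟩

/-- The restriction of an element of `relHomeo` to a homeomorphism of `Σ`. -/
noncomputable def restrictSurface : D.relHomeo →* basedHomeo D.surface D.base where
  toFun h :=
    ⟨{  toFun := fun x => ⟨h.1 x, D.relHomeo_mem_surface h x.2⟩
        invFun := fun x => ⟨h.1.symm x, D.relHomeo_mem_surface h⁻¹ x.2⟩
        left_inv := fun x => Subtype.ext (h.1.symm_apply_apply x)
        right_inv := fun x => Subtype.ext (h.1.apply_symm_apply x)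
        continuous_toFun := (h.1.continuous.comp continuous_subtype_val).subtype_mk _
        continuous_invFun := (h.1.symm.continuous.comp continuous_subtype_val).subtype_mk _ },
      Subtype.ext (h.2 _)⟩
  map_one' := rfl
  map_mul' _ _ := rfl

/-- An element of `relHomeo` as a homeomorphism of `V` that fixes `⋆`. -/
noncomputable def relHomeoToBased : D.relHomeo →* basedHomeo V (D.base : V) :=
  Subgroup.inclusion fun _ hh => hh _

theorem isotopy_slice_mem_surface {Φ : (I × V) ≃ₜ (I × V)} {h : V ≃ₜ V} (hΦ : D.IsIsotopy Φ h)
    (t : I) {x : V} (hx : x ∈ D.surface) : (Φ (t, x)).2 ∈ D.surface := by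
  have hlev : ∀ x, Φ (t, x) = (t, (Φ (t, x)).2) := fun x => Prod.ext (hΦ.level _) rfl
  have hlev' : ∀ x, Φ.symm (t, x) = (t, (Φ.symm (t, x)).2) := fun x => by
    refine Prod.ext ?_ rfl
    have := hΦ.level (Φ.symm (t, x))
    rw [Homeomorph.apply_symm_apply] at this
    exact this.symm
  let k : V ≃ₜ V :=
    { toFun := fun x => (Φ (t, x)).2
      invFun := fun x => (Φ.symm (t, x)).2
      left_inv := fun x => by
        change (Φ.symm (t, (Φ (t, x)).2)).2 = x
        rw [← hlev, Homeomorph.symm_apply_apply]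
      right_inv := fun x => by
        change (Φ (t, (Φ.symm (t, x)).2)).2 = x
        rw [← hlev', Homeomorph.apply_symm_apply]
      continuous_toFun := by fun_prop
      continuous_invFun := by fun_prop }
  exact D.relHomeo_mem_surface ⟨k, fun z => congrArg Prod.snd (hΦ.fix t z)⟩ hx

/-- The action of the handlebody group on `π = π₁(Σ,⋆)`. -/
noncomputable def surfaceAction : D.HandlebodyGroup →* MulAut D.surfaceGroup :=
  QuotientGroup.lift D.isotopicToId ((pi1Action D.base).comp D.restrictSurface) <| by
    rintro h ⟨Φ, hΦ⟩
    refine pi1Action_eq_one_of_homotopy D.base (D.restrictSurface h)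
      ⟨fun q => ⟨(Φ (q.1, q.2)).2, D.isotopy_slice_mem_surface hΦ q.1 q.2.2⟩, ?_⟩ ?_ ?_ ?_
    · exact Continuous.subtype_mk (by fun_prop) _
    · exact fun y => Subtype.ext (congrArg Prod.snd (hΦ.zero y))
    · exact fun y => Subtype.ext (congrArg Prod.snd (hΦ.one y))
    · exact fun t => Subtype.ext (congrArg Prod.snd (hΦ.fix t _))

/-- The action `h ↦ h^F` of the handlebody group on `F = π₁(V,⋆)`. -/
noncomputable def bodyAction : D.HandlebodyGroup →* MulAut D.bodyGroup :=
  QuotientGroup.lift D.isotopicToId ((pi1Action (D.base : V)).comp D.relHomeoToBased) <| by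
    rintro h ⟨Φ, hΦ⟩
    refine pi1Action_eq_one_of_homotopy (D.base : V) (D.relHomeoToBased h)
      ⟨fun q => (Φ q).2, by fun_prop⟩ ?_ ?_ ?_
    · exact fun y => congrArg Prod.snd (hΦ.zero y)
    · exact fun y => congrArg Prod.snd (hΦ.one y)
    · exact fun t => congrArg Prod.snd (hΦ.fix t _)

/-- The twist group `𝒯`: the kernel of the action of `ℋ` on `F`. -/
noncomputable def twistGroup : Subgroup D.HandlebodyGroup := D.bodyAction.ker

instance twistGroup_normal : D.twistGroup.Normal := by
  unfold twistGroup; infer_instance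

/-- A system `(α,β)` of `g` meridians and `g` parallels, as a basis of the free group `π`:
the classes `α₁,…,α_g,β₁,…,β_g` form a basis of `π`, the meridians `α_i` generate the kernel of
`ϖ : π → F` as a normal subgroup, and `ζ⁻¹ = [β₁⁻¹,α₁] ⋯ [β_g⁻¹,α_g]` with
`[x,y] = x y x⁻¹ y⁻¹`. -/
structure CurveSystem (g : ℕ) where
  /-- `basis (Sum.inl i)` is `α_i`, and `basis (Sum.inr i)` is `β_i` -/
  basis : FreeGroupBasis (Fin g ⊕ Fin g) D.surfaceGroup
  ker_proj : D.proj.ker = Subgroup.normalClosure (Set.range fun i => basis (Sum.inl i))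
  zeta_inv : D.zeta⁻¹ =
    (List.ofFn fun i : Fin g =>
      (basis (Sum.inr i))⁻¹ * basis (Sum.inl i) * basis (Sum.inr i) * (basis (Sum.inl i))⁻¹).prod

end BoundaryDisk

/-! ### Fox calculus -/

section Fox

variable {ι G : Type*} [Group G]

/-- The affine bijection `v ↦ w v + a` of `ℤ[G]`. -/
noncomputable def foxAffine (w : G) (a : MonoidAlgebra ℤ G) : Equiv.Perm (MonoidAlgebra ℤ G) where
  toFun v := MonoidAlgebra.of ℤ G w * v + a
  invFun v := MonoidAlgebra.of ℤ G w⁻¹ * (v - a)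
  left_inv v := by
    beta_reduce
    rw [add_sub_cancel_right, ← mul_assoc, ← map_mul, inv_mul_cancel, map_one, one_mul]
  right_inv v := by
    beta_reduce
    rw [← mul_assoc, ← map_mul, mul_inv_cancel, map_one, one_mul, sub_add_cancel]

open Classical in
/-- The left Fox derivative `∂w/∂z_i` of an element `w` of a free group with basis `(z_j)`. The
basis element `z_j` acts on `ℤ[G]` by `v ↦ z_j v + δ_{ij}`, and `∂w/∂z_i` is the image of `0`
under `w`. -/
noncomputable def foxGroup (b : FreeGroupBasis ι G) (i : ι) (w : G) : MonoidAlgebra ℤ G :=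
  b.lift (fun j => foxAffine (b j) (if j = i then 1 else 0)) w 0

/-- The left Fox derivative `∂/∂z_i : ℤ[G] → ℤ[G]`. -/
noncomputable def foxDeriv (b : FreeGroupBasis ι G) (i : ι) (w : MonoidAlgebra ℤ G) :
    MonoidAlgebra ℤ G :=
  w.coeff.sum fun u n => n • foxGroup b i u

theorem foxDeriv_of (b : FreeGroupBasis ι G) (i : ι) (w : G) :
    foxDeriv b i (MonoidAlgebra.of ℤ G w) = foxGroup b i w := by
  simp [foxDeriv]

open Classical in
theorem foxGroup_basis (b : FreeGroupBasis ι G) (i j : ι) :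
    foxGroup b i (b j) = if j = i then 1 else 0 := by
  have h : b.lift (fun j => foxAffine (b j) (if j = i then 1 else 0)) (b j) =
      foxAffine (b j) (if j = i then 1 else 0) :=
    congrFun (b.lift.symm_apply_apply _) j
  rw [foxGroup, h]
  simp [foxAffine]

theorem foxGroup_mul (b : FreeGroupBasis ι G) (i : ι) (u w : G) :
    foxGroup b i (u * w) = foxGroup b i u + MonoidAlgebra.of ℤ G u * foxGroup b i w := by
  classical
  have key : ∀ (u : G) (v : MonoidAlgebra ℤ G),
      b.lift (fun j => foxAffine (b j) (if j = i then 1 else 0)) u v =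
        foxGroup b i u + MonoidAlgebra.of ℤ G u * v := by
    let ψ : G →* Equiv.Perm (MonoidAlgebra ℤ G) :=
      b.lift (fun j => foxAffine (b j) (if j = i then 1 else 0))
    let S : Subgroup G :=
      { carrier := {u | ∀ v, ψ u v = ψ u 0 + MonoidAlgebra.of ℤ G u * v}
        one_mem' := fun v => by
          rw [map_one, map_one, one_mul, Equiv.Perm.one_apply, Equiv.Perm.one_apply, zero_add]
        mul_mem' := by
          intro x y hx hy v
          rw [map_mul, Equiv.Perm.mul_apply, Equiv.Perm.mul_apply, hy v, hx, hx (ψ y 0), map_mul]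
          noncomm_ring
        inv_mem' := by
          intro x hx v
          apply (ψ x).injective
          rw [hx (_ + _), ← Equiv.Perm.mul_apply, ← map_mul, mul_inv_cancel, map_one, mul_add,
            ← mul_assoc, ← map_mul, mul_inv_cancel, map_one, one_mul, ← add_assoc, ← hx,
            ← Equiv.Perm.mul_apply, ← map_mul, mul_inv_cancel, map_one]
          simp }
    have hS : ∀ w : FreeGroup ι, b.repr.symm w ∈ S := by
      intro w
      induction w using FreeGroup.induction_on with
      | C1 => simp
      | of j =>
        intro v
        have h : ψ (b j) = foxAffine (b j) (if j = i then 1 else 0) :=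
          congrFun (b.lift.symm_apply_apply _) j
        change ψ (b j) v = ψ (b j) 0 + MonoidAlgebra.of ℤ G (b j) * v
        rw [h]
        simp [foxAffine, add_comm]
      | inv_of j h => simpa using S.inv_mem h
      | mul x y hx hy => simpa using S.mul_mem hx hy
    intro u v
    have := hS (b.repr u)
    rw [MulEquiv.symm_apply_apply] at this
    exact this v
  have h := key u (foxGroup b i w)
  rw [← h, foxGroup, map_mul, Equiv.Perm.mul_apply]
  rfl

/-- The defining identity of the Fox derivatives, `w - 1 = ∑ i, ∂w/∂z_i (z_i - 1)` for `w ∈ G`. -/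
theorem foxGroup_identity [Fintype ι] (b : FreeGroupBasis ι G) (w : G) :
    MonoidAlgebra.of ℤ G w - 1 =
      ∑ i, foxGroup b i w * (MonoidAlgebra.of ℤ G (b i) - 1) := by
  classical
  have h1 : ∀ i, foxGroup b i 1 = 0 := fun i => by
    have := foxGroup_mul b i 1 1
    rwa [mul_one, map_one, one_mul, left_eq_add] at this
  let S : Subgroup G :=
    { carrier := {u | MonoidAlgebra.of ℤ G u - 1 =
        ∑ i, foxGroup b i u * (MonoidAlgebra.of ℤ G (b i) - 1)}
      one_mem' := by simp only [Set.mem_ofPred_eq, h1, map_one, sub_self, zero_mul,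
        Finset.sum_const_zero]
      mul_mem' := by
        intro x y hx hy
        simp only [Set.mem_ofPred_eq] at hx hy ⊢
        simp only [foxGroup_mul, add_mul, Finset.sum_add_distrib, mul_assoc, ← Finset.mul_sum,
          ← hx, ← hy, map_mul]
        noncomm_ring
      inv_mem' := by
        intro x hx
        simp only [Set.mem_ofPred_eq] at hx ⊢
        have h2 : ∀ i, foxGroup b i x⁻¹ = -(MonoidAlgebra.of ℤ G x⁻¹ * foxGroup b i x) := fun i => by
          have := foxGroup_mul b i x⁻¹ x
          rw [inv_mul_cancel, h1] at this
          exact eq_neg_of_add_eq_zero_left this.symm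
        simp only [h2, neg_mul, mul_assoc, Finset.sum_neg_distrib, ← Finset.mul_sum, ← hx]
        rw [mul_sub, ← map_mul, inv_mul_cancel, map_one, mul_one, neg_sub] }
  have hS : ∀ w : FreeGroup ι, b.repr.symm w ∈ S := by
    intro w
    induction w using FreeGroup.induction_on with
    | C1 => simp
    | of j =>
      change MonoidAlgebra.of ℤ G (b j) - 1 =
        ∑ i, foxGroup b i (b j) * (MonoidAlgebra.of ℤ G (b i) - 1)
      simp only [foxGroup_basis, ite_mul, one_mul, zero_mul, Finset.sum_ite_eq, Finset.mem_univ,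
        if_true]
    | inv_of j h => simpa using S.inv_mem h
    | mul x y hx hy => simpa using S.mul_mem hx hy
  have := hS (b.repr w)
  rwa [MulEquiv.symm_apply_apply] at this

end Fox

/-- The linear map `ℤ[G] → ℤ[G]`, `u ↦ ū`, with `ū = u⁻¹` for `u ∈ G`. -/
noncomputable def bar {G : Type*} [Group G] (w : MonoidAlgebra ℤ G) : MonoidAlgebra ℤ G :=
  MonoidAlgebra.mapDomain (fun u => u⁻¹) w

/-- The conjugate transpose of a matrix over a group ring. -/
noncomputable def dagger {G : Type*} [Group G] {m n : Type*} (M : Matrix m n (MonoidAlgebra ℤ G)) :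
    Matrix n m (MonoidAlgebra ℤ G) :=
  Matrix.of fun i j => bar (M j i)

/-! ### The Magnus representations -/

namespace BoundaryDisk

variable {V : Type*} [TopologicalSpace V] {D : BoundaryDisk V} {g : ℕ}

namespace CurveSystem

variable (B : D.CurveSystem g)

/-- The `(k,l)` entry of `J^F(h)`, namely the image in `ℤ[F]` of the conjugate of
`∂h(z_l)/∂z_k ∈ ℤ[π]`, where `z = (α,β)`. -/
noncomputable def jacobianF (h : D.HandlebodyGroup) :
    Matrix (Fin g ⊕ Fin g) (Fin g ⊕ Fin g) (MonoidAlgebra ℤ D.bodyGroup) :=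
  Matrix.of fun k l => MonoidAlgebra.mapDomainRingHom ℤ D.proj
    (bar (foxDeriv B.basis k (MonoidAlgebra.of ℤ _ (D.surfaceAction h (B.basis l)))))

/-- `Mag_0^1(h)`, the upper-left block, whose `(i,j)` entry comes from `∂h(α_j)/∂α_i`. -/
noncomputable def magAlpha (h : D.HandlebodyGroup) :
    Matrix (Fin g) (Fin g) (MonoidAlgebra ℤ D.bodyGroup) :=
  (B.jacobianF h).toBlocks₁₁

/-- `Mag(f)` for `f` in the twist group: the upper-right block, whose `(i,j)` entry comes from
`∂f(β_j)/∂α_i`. -/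
noncomputable def mag (f : D.twistGroup) :
    Matrix (Fin g) (Fin g) (MonoidAlgebra ℤ D.bodyGroup) :=
  (B.jacobianF f.1).toBlocks₁₂

end CurveSystem

end BoundaryDisk

/-! Every mapping class rel `D` fixes `ζ⁻¹`, and both assertions come from differentiating `φ(ζ⁻¹) =
ζ⁻¹` twice, where `φ` is the action of `h` on `π`. Let `J` be the conjugate of the transposed Fox
Jacobian of `φ`, reduced to `ℤ[F]`, and let `H` be the matrix of second derivatives of `ζ⁻¹`, each
one a Fox derivative followed by a conjugate Fox derivative (`coFox`). The chain rules for the two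
kinds of derivative give `H = J · h^F(H) · J†` (`foxHessian_eq`).

In the basis `(α,β)` the matrix `H` has rows `(A, -1)` and `(1, 0)` (`foxHessian_surfaceRelator`);
the block `A` never has to be computed. Since `φ` preserves `ker ϖ`, the matrix `J` has rows `(P,
Q)` and `(0, S)`. Comparing blocks yields `S P† = 1` and `A = (P h^F(A) + Q) P† - P Q†`
(`foxJacobian_blocks`).

For a twist, `h^F = id` and `S = 1`, hence `P = 1`; then `A` cancels and leaves `Q = Q†`, the
hermitian property. For the conjugation formula, the crossed product rule for Jacobians
(`foxJacobian_comp`) is applied to `(hfh⁻¹)h = hf`. Its upper-right block reads `Mag(hfh⁻¹) S = P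
h^F(Mag(f))`, and `S P† = 1` removes `S`. -/

/-! ### The involution of a group ring -/

section GroupRing

variable {G H : Type*} [Group G] [Group H]

/-- Additive maps on `ℤ[G]` are determined by their values on `G`. -/
theorem groupRing_addHom_congr {M : Type*} [AddCommGroup M] {φ ψ : MonoidAlgebra ℤ G →+ M}
    (h : ∀ u : G, φ (MonoidAlgebra.of ℤ G u) = ψ (MonoidAlgebra.of ℤ G u))
    (a : MonoidAlgebra ℤ G) : φ a = ψ a := by
  refine DFunLike.congr_fun (MonoidAlgebra.addMonoidHom_ext fun u n => ?_) a
  have hs : (MonoidAlgebra.single u n : MonoidAlgebra ℤ G) = n • MonoidAlgebra.of ℤ G u := by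
    simp [MonoidAlgebra.of_apply]
  rw [hs, map_zsmul, map_zsmul, h]

theorem bar_of (u : G) : bar (MonoidAlgebra.of ℤ G u) = MonoidAlgebra.of ℤ G u⁻¹ := by
  simp [bar, MonoidAlgebra.of_apply]

/-- The involution `u ↦ ū` as an additive map. -/
noncomputable def barHom : MonoidAlgebra ℤ G →+ MonoidAlgebra ℤ G where
  toFun := bar
  map_zero' := MonoidAlgebra.mapDomain_zero _
  map_add' := MonoidAlgebra.mapDomain_add _

theorem barHom_apply (a : MonoidAlgebra ℤ G) : barHom a = bar a := rfl

theorem bar_zero : bar (0 : MonoidAlgebra ℤ G) = 0 := map_zero barHom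

theorem bar_one : bar (1 : MonoidAlgebra ℤ G) = 1 := by
  rw [← map_one (MonoidAlgebra.of ℤ G), bar_of, inv_one]

theorem bar_add (a c : MonoidAlgebra ℤ G) : bar (a + c) = bar a + bar c := map_add barHom a c

theorem bar_sum {κ : Type*} (s : Finset κ) (a : κ → MonoidAlgebra ℤ G) :
    bar (∑ i ∈ s, a i) = ∑ i ∈ s, bar (a i) := map_sum barHom a s

theorem bar_bar (a : MonoidAlgebra ℤ G) : bar (bar a) = a :=
  groupRing_addHom_congr (φ := barHom.comp barHom) (ψ := AddMonoidHom.id _)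
    (fun u => by simp only [AddMonoidHom.comp_apply, barHom_apply, bar_of, inv_inv,
      AddMonoidHom.id_apply]) a

theorem bar_mul (a c : MonoidAlgebra ℤ G) : bar (a * c) = bar c * bar a := by
  refine groupRing_addHom_congr (φ := barHom.comp (AddMonoidHom.mulRight c))
    (ψ := (AddMonoidHom.mulLeft (bar c)).comp barHom) (fun u => ?_) a
  refine groupRing_addHom_congr
    (φ := barHom.comp (AddMonoidHom.mulLeft (MonoidAlgebra.of ℤ G u)))
    (ψ := (AddMonoidHom.mulRight (bar (MonoidAlgebra.of ℤ G u))).comp barHom) (fun v => ?_) c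
  simp only [AddMonoidHom.comp_apply, AddMonoidHom.coe_mulLeft, AddMonoidHom.coe_mulRight,
    barHom_apply, bar_of, ← map_mul, _root_.mul_inv_rev]

theorem mapDomainRingHom_of (p : G →* H) (u : G) :
    MonoidAlgebra.mapDomainRingHom ℤ p (MonoidAlgebra.of ℤ G u) = MonoidAlgebra.of ℤ H (p u) := by
  simp [MonoidAlgebra.of_apply]

theorem mapDomainRingHom_bar (p : G →* H) (a : MonoidAlgebra ℤ G) :
    MonoidAlgebra.mapDomainRingHom ℤ p (bar a) = bar (MonoidAlgebra.mapDomainRingHom ℤ p a) :=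
  groupRing_addHom_congr
    (φ := (MonoidAlgebra.mapDomainRingHom ℤ p : _ →+ MonoidAlgebra ℤ H).comp barHom)
    (ψ := barHom.comp (MonoidAlgebra.mapDomainRingHom ℤ p : _ →+ MonoidAlgebra ℤ H))
    (fun u => by
      simp only [AddMonoidHom.comp_apply, barHom_apply, AddMonoidHom.coe_coe, bar_of,
        mapDomainRingHom_of, map_inv]) a

/-- Turns the action on `π` into the action on `F` once coefficients are reduced; this is how `h^F`
enters the matrix identities. -/
theorem mapDomainRingHom_square {F : Type*} [Group F] {p : G →* F} {φ : G →* G} {ψ : F →* F}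
    (h : ∀ u, p (φ u) = ψ (p u)) (a : MonoidAlgebra ℤ G) :
    MonoidAlgebra.mapDomainRingHom ℤ p (MonoidAlgebra.mapDomainRingHom ℤ φ a) =
      MonoidAlgebra.mapDomainRingHom ℤ ψ (MonoidAlgebra.mapDomainRingHom ℤ p a) := by
  have hc : p.comp φ = ψ.comp p := MonoidHom.ext h
  rw [← RingHom.comp_apply, ← RingHom.comp_apply, ← MonoidAlgebra.mapDomainRingHom_comp,
    ← MonoidAlgebra.mapDomainRingHom_comp, hc]

/-- The augmentation `ℤ[G] → ℤ`. -/
noncomputable def augmentation : MonoidAlgebra ℤ G →+* ℤ :=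
  (MonoidAlgebra.lift ℤ ℤ G 1 : MonoidAlgebra ℤ G →ₐ[ℤ] ℤ)

theorem augmentation_of (u : G) : augmentation (MonoidAlgebra.of ℤ G u) = 1 := by
  simp [augmentation, MonoidAlgebra.of_apply]

end GroupRing

/-! ### Fox derivatives and their conjugates -/

section FoxRules

variable {ι G F : Type*} [Group G] [Group F] (b : FreeGroupBasis ι G)

theorem FreeGroupBasis.subgroup_eq_top (S : Subgroup G) (h : ∀ i, b i ∈ S) : S = ⊤ := by
  refine (Subgroup.eq_top_iff' S).2 fun w => ?_
  have hS : ∀ w : FreeGroup ι, b.repr.symm w ∈ S := by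
    intro w
    induction w using FreeGroup.induction_on with
    | C1 => simp
    | of j => exact h j
    | inv_of j h => simpa using S.inv_mem h
    | mul x y hx hy => simpa using S.mul_mem hx hy
  simpa using hS (b.repr w)

theorem foxGroup_one (i : ι) : foxGroup b i 1 = 0 := by
  have := foxGroup_mul b i 1 1
  rwa [mul_one, map_one, one_mul, left_eq_add] at this

theorem foxGroup_inv (i : ι) (w : G) :
    foxGroup b i w⁻¹ = -(MonoidAlgebra.of ℤ G w⁻¹ * foxGroup b i w) := by
  have := foxGroup_mul b i w⁻¹ w
  rw [inv_mul_cancel, foxGroup_one] at this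
  exact eq_neg_of_add_eq_zero_left this.symm

theorem foxGroup_basis_self (i : ι) : foxGroup b i (b i) = 1 := by
  rw [foxGroup_basis, if_pos rfl]

theorem foxGroup_basis_of_ne {i j : ι} (h : j ≠ i) : foxGroup b i (b j) = 0 := by
  rw [foxGroup_basis, if_neg h]

/-- The Fox derivative as an additive map. -/
noncomputable def foxDerivHom (i : ι) : MonoidAlgebra ℤ G →+ MonoidAlgebra ℤ G where
  toFun := foxDeriv b i
  map_zero' := by simp [foxDeriv]
  map_add' x y := by
    simp only [foxDeriv, MonoidAlgebra.coeff_add]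
    exact Finsupp.sum_add_index' (fun _ => zero_smul _ _) fun _ _ _ => add_smul _ _ _

theorem foxDerivHom_of (i : ι) (w : G) :
    foxDerivHom b i (MonoidAlgebra.of ℤ G w) = foxGroup b i w := foxDeriv_of b i w

/-- The conjugate `a ↦ bar (∂ (bar a) / ∂ z_i)` of a Fox derivative, which is the coordinate of
index `i` with respect to the basis `(z_j⁻¹ - 1)` of the augmentation ideal as a right module. -/
noncomputable def coFox (i : ι) : MonoidAlgebra ℤ G →+ MonoidAlgebra ℤ G :=
  barHom.comp ((foxDerivHom b i).comp barHom)

theorem coFox_of (i : ι) (u : G) :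
    coFox b i (MonoidAlgebra.of ℤ G u) = bar (foxGroup b i u⁻¹) := by
  simp only [coFox, AddMonoidHom.comp_apply, barHom_apply, bar_of, foxDerivHom_of]

theorem coFox_of_mul_of (i : ι) (u v : G) :
    coFox b i (MonoidAlgebra.of ℤ G (u * v)) =
      coFox b i (MonoidAlgebra.of ℤ G u) * MonoidAlgebra.of ℤ G v +
        coFox b i (MonoidAlgebra.of ℤ G v) := by
  rw [coFox_of, coFox_of, coFox_of, _root_.mul_inv_rev, foxGroup_mul, bar_add, bar_mul, bar_of,
    inv_inv, add_comm]

/-- Conjugation exchanges the two sides in the Fox product rule, so the augmentation falls on the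
left factor. The second term disappears when `a` lies in the augmentation ideal. -/
theorem coFox_mul (i : ι) (a c : MonoidAlgebra ℤ G) :
    coFox b i (a * c) = coFox b i a * c + augmentation a • coFox b i c := by
  refine groupRing_addHom_congr (φ := (coFox b i).comp (AddMonoidHom.mulRight c))
    (ψ := (AddMonoidHom.mulRight c).comp (coFox b i) +
      (AddMonoidHom.flip (smulAddHom ℤ _) (coFox b i c)).comp
        (augmentation : MonoidAlgebra ℤ G →+* ℤ).toAddMonoidHom) (fun u => ?_) a
  refine groupRing_addHom_congr
    (φ := (coFox b i).comp (AddMonoidHom.mulLeft (MonoidAlgebra.of ℤ G u)))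
    (ψ := AddMonoidHom.mulLeft (coFox b i (MonoidAlgebra.of ℤ G u)) +
      augmentation (MonoidAlgebra.of ℤ G u) • coFox b i) (fun v => ?_) c
  simp only [AddMonoidHom.comp_apply, AddMonoidHom.add_apply, AddMonoidHom.coe_mulLeft,
    augmentation_of, one_smul, ← map_mul]
  exact coFox_of_mul_of b i u v

variable [Fintype ι]

/-- The chain rule for Fox derivatives. -/
theorem foxGroup_map (φ : G →* G) (k : ι) (u : G) :
    foxGroup b k (φ u) =
      ∑ j, MonoidAlgebra.mapDomainRingHom ℤ φ (foxGroup b j u) * foxGroup b k (φ (b j)) := by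
  classical
  let S : Subgroup G :=
    { carrier := {u | foxGroup b k (φ u) =
        ∑ j, MonoidAlgebra.mapDomainRingHom ℤ φ (foxGroup b j u) * foxGroup b k (φ (b j))}
      one_mem' := by simp [foxGroup_one]
      mul_mem' := by
        intro x y hx hy
        simp only [Set.mem_ofPred_eq] at hx hy ⊢
        simp only [map_mul, foxGroup_mul, map_add, mapDomainRingHom_of, add_mul,
          Finset.sum_add_distrib, mul_assoc, ← Finset.mul_sum, ← hx, ← hy]
      inv_mem' := by
        intro x hx
        simp only [Set.mem_ofPred_eq] at hx ⊢
        simp only [map_inv, foxGroup_inv, map_neg, map_mul, mapDomainRingHom_of, neg_mul,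
          Finset.sum_neg_distrib, mul_assoc, ← Finset.mul_sum, ← hx] }
  have hS : u ∈ S := by
    rw [b.subgroup_eq_top S fun i => ?_]
    · trivial
    · change foxGroup b k (φ (b i)) = _
      simp [foxGroup_basis]
  exact hS

/-- The conjugate of the chain rule `foxGroup_map`: the Jacobian coefficients now stand on the left.
-/
theorem coFox_map (φ : G →* G) (k : ι) (a : MonoidAlgebra ℤ G) :
    coFox b k (MonoidAlgebra.mapDomainRingHom ℤ φ a) =
      ∑ l, bar (foxGroup b k (φ (b l))) *
        MonoidAlgebra.mapDomainRingHom ℤ φ (coFox b l a) := by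
  have := groupRing_addHom_congr
    (φ := (coFox b k).comp (MonoidAlgebra.mapDomainRingHom ℤ φ).toAddMonoidHom)
    (ψ := ∑ l, (AddMonoidHom.mulLeft (bar (foxGroup b k (φ (b l))))).comp
      ((MonoidAlgebra.mapDomainRingHom ℤ φ).toAddMonoidHom.comp (coFox b l))) (fun u => ?_) a
  · simpa using this
  · simp only [AddMonoidHom.comp_apply, RingHom.toAddMonoidHom_eq_coe, AddMonoidHom.coe_coe,
      AddMonoidHom.finsetSum_apply, AddMonoidHom.coe_mulLeft, mapDomainRingHom_of, coFox_of]
    rw [← map_inv, foxGroup_map, bar_sum]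
    exact Finset.sum_congr rfl fun l _ => by rw [bar_mul, mapDomainRingHom_bar]

/-! ### Jacobians and second derivatives over the reduced group ring. -/

/-- The conjugate of the transposed Jacobian matrix of `φ`, with coefficients reduced along `p`. -/
noncomputable def foxJacobian (p : G →* F) (φ : G →* G) : Matrix ι ι (MonoidAlgebra ℤ F) :=
  Matrix.of fun k l => MonoidAlgebra.mapDomainRingHom ℤ p (bar (foxGroup b k (φ (b l))))

theorem foxJacobian_comp (p : G →* F) (φ χ : G →* G) (ψ : F →* F)
    (h : ∀ u, p (φ u) = ψ (p u)) :
    foxJacobian b p (φ.comp χ) =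
      foxJacobian b p φ * (foxJacobian b p χ).map (MonoidAlgebra.mapDomainRingHom ℤ ψ) := by
  ext1 k l
  simp only [foxJacobian, Matrix.mul_apply, Matrix.map_apply, Matrix.of_apply,
    MonoidHom.comp_apply]
  rw [foxGroup_map, bar_sum, map_sum]
  refine Finset.sum_congr rfl fun j _ => ?_
  rw [bar_mul, map_mul, ← mapDomainRingHom_bar, mapDomainRingHom_square h]

/-- The matrix of the second derivatives of `w`, with coefficients reduced along `p`. -/
noncomputable def foxHessian (p : G →* F) (w : G) : Matrix ι ι (MonoidAlgebra ℤ F) :=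
  Matrix.of fun k j => MonoidAlgebra.mapDomainRingHom ℤ p (coFox b k (foxGroup b j w))

/-- The Jacobian matrix of an endomorphism that fixes `w` preserves the sesquilinear form given by
the second derivatives of `w`. -/
theorem foxHessian_eq (p : G →* F) (φ : G →* G) (ψ : F →* F) (h : ∀ u, p (φ u) = ψ (p u))
    {w : G} (hw : φ w = w) (haug : ∀ j, augmentation (foxGroup b j w) = 0) :
    foxHessian b p w =
      foxJacobian b p φ * (foxHessian b p w).map (MonoidAlgebra.mapDomainRingHom ℤ ψ) *
        dagger (foxJacobian b p φ) := by
  have haug' : ∀ j, augmentation (MonoidAlgebra.mapDomainRingHom ℤ φ (foxGroup b j w)) = 0 := by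
    intro j
    rw [← haug j]
    exact groupRing_addHom_congr
      (φ := (augmentation : MonoidAlgebra ℤ G →+* ℤ).toAddMonoidHom.comp
        (MonoidAlgebra.mapDomainRingHom ℤ φ).toAddMonoidHom)
      (ψ := (augmentation : MonoidAlgebra ℤ G →+* ℤ).toAddMonoidHom)
      (fun u => by
        simp only [AddMonoidHom.comp_apply, RingHom.toAddMonoidHom_eq_coe, AddMonoidHom.coe_coe,
          mapDomainRingHom_of, augmentation_of]) _
  ext1 k i
  simp only [foxHessian, foxJacobian, dagger, Matrix.mul_apply, Matrix.map_apply, Matrix.of_apply]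
  -- First differentiation of `φ w = w`. Applying `coFox b k` to the result produces the second
  -- Jacobian factor, and `haug'` kills the remainder of the product rule.
  have hd := foxGroup_map b φ i w
  rw [hw] at hd
  rw [hd, map_sum, map_sum]
  refine Finset.sum_congr rfl fun j _ => ?_
  rw [coFox_mul, haug', zero_smul, add_zero, map_mul, coFox_map, map_sum, mapDomainRingHom_bar p,
    bar_bar]
  refine congrArg (· * _) (Finset.sum_congr rfl fun l _ => ?_)
  rw [map_mul, mapDomainRingHom_square h]

end FoxRules

/-! ### Meridians and parallels -/

section MeridianBasis

variable {g : ℕ} {G F : Type*} [Group G] [Group F] (b : FreeGroupBasis (Fin g ⊕ Fin g) G)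
  (p : G →* F)

/-- The product of the commutators `[β_i⁻¹, α_i]`. -/
def surfaceRelator : G :=
  (List.ofFn fun i : Fin g =>
    (b (Sum.inr i))⁻¹ * b (Sum.inl i) * b (Sum.inr i) * (b (Sum.inl i))⁻¹).prod

/-- The derivative along a parallel vanishes on the meridians, and over `ℤ[F]` this vanishing
survives products, inverses and conjugation within `ker p`. -/
theorem foxGroup_inr_of_mem_ker
    (hp : p.ker = Subgroup.normalClosure (Set.range fun i => b (Sum.inl i))) (j : Fin g) {u : G}
    (hu : u ∈ p.ker) : MonoidAlgebra.mapDomainRingHom ℤ p (foxGroup b (Sum.inr j) u) = 0 := by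
  -- The condition `p u = 1` is carried along because normality needs it.
  let S : Subgroup G :=
    { carrier := {u | p u = 1 ∧ MonoidAlgebra.mapDomainRingHom ℤ p (foxGroup b (Sum.inr j) u) = 0}
      one_mem' := by simp [foxGroup_one]
      mul_mem' := by
        rintro x y ⟨hx, hx'⟩ ⟨hy, hy'⟩
        refine ⟨by rw [map_mul, hx, hy, one_mul], ?_⟩
        rw [foxGroup_mul, map_add, map_mul, hx', hy', mul_zero, add_zero]
      inv_mem' := by
        rintro x ⟨hx, hx'⟩
        refine ⟨by rw [map_inv, hx, inv_one], ?_⟩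
        rw [foxGroup_inv, map_neg, map_mul, hx', mul_zero, neg_zero] }
  have hn : S.Normal := ⟨by
    rintro x ⟨hx, hx'⟩ y
    refine ⟨by rw [map_mul, map_mul, hx, mul_one, map_inv, mul_inv_cancel], ?_⟩
    -- Here `∂(y x y⁻¹) = ∂y + y ∂x - y x y⁻¹ ∂y`; the outer terms cancel after reduction since `p x
    -- = 1`.
    rw [foxGroup_mul, foxGroup_mul, foxGroup_inv, map_add, map_add, map_mul, hx', mul_zero,
      add_zero, map_mul, mapDomainRingHom_of, map_mul, hx, mul_one, map_neg, map_mul,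
      mapDomainRingHom_of, mul_neg, ← mul_assoc, ← map_mul, map_inv, mul_inv_cancel, map_one,
      one_mul, add_neg_cancel]⟩
  have hS : Subgroup.normalClosure (Set.range fun i => b (Sum.inl i)) ≤ S := by
    refine Subgroup.normalClosure_le_normal ?_
    rintro _ ⟨i, rfl⟩
    refine ⟨?_, ?_⟩
    · have : b (Sum.inl i) ∈ p.ker := hp ▸ Subgroup.subset_normalClosure ⟨i, rfl⟩
      exact this
    · rw [foxGroup_basis_of_ne b Sum.inl_ne_inr, map_zero]
  exact (hS (hp ▸ hu)).2

theorem coFox_inr_of_mem_ker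
    (hp : p.ker = Subgroup.normalClosure (Set.range fun i => b (Sum.inl i))) (j : Fin g) {u : G}
    (hu : u ∈ p.ker) :
    MonoidAlgebra.mapDomainRingHom ℤ p (coFox b (Sum.inr j) (MonoidAlgebra.of ℤ G u)) = 0 := by
  rw [coFox_of, mapDomainRingHom_bar, foxGroup_inr_of_mem_ker b p hp j (p.ker.inv_mem hu), bar_zero]

/-- The Fox derivatives of the relator `ζ⁻¹` with respect to `α_i` and `β_i`. -/
theorem foxGroup_surfaceRelator (hp : ∀ i, p (b (Sum.inl i)) = 1) (i : Fin g) :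
    ∃ u v : G, u ∈ p.ker ∧ v ∈ p.ker ∧
      foxGroup b (Sum.inl i) (surfaceRelator b) =
        MonoidAlgebra.of ℤ G (u * (b (Sum.inr i))⁻¹) - MonoidAlgebra.of ℤ G v ∧
      foxGroup b (Sum.inr i) (surfaceRelator b) =
        MonoidAlgebra.of ℤ G (u * (b (Sum.inr i))⁻¹ * b (Sum.inl i)) -
          MonoidAlgebra.of ℤ G (u * (b (Sum.inr i))⁻¹) := by
  let c : Fin g → G := fun i =>
    (b (Sum.inr i))⁻¹ * b (Sum.inl i) * b (Sum.inr i) * (b (Sum.inl i))⁻¹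
  have hc : ∀ i, c i ∈ p.ker := fun i => by
    rw [MonoidHom.mem_ker]
    simp [c, hp]
  have hprod : ∀ l : List (Fin g), (l.map c).prod ∈ p.ker := fun l =>
    p.ker.list_prod_mem fun x hx => by
      obtain ⟨j, -, rfl⟩ := List.mem_map.1 hx
      exact hc j
  have hzero : ∀ x : Fin g ⊕ Fin g, x = Sum.inl i ∨ x = Sum.inr i → ∀ l : List (Fin g), i ∉ l →
      foxGroup b x (l.map c).prod = 0 := by
    intro x hx l
    induction l with
    | nil => intro _; simp [foxGroup_one]
    | cons j l ih =>
      intro hl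
      rw [List.mem_cons, not_or] at hl
      have h1 : Sum.inl j ≠ x := by rcases hx with rfl | rfl <;> simp [Ne.symm hl.1]
      have h2 : Sum.inr j ≠ x := by rcases hx with rfl | rfl <;> simp [Ne.symm hl.1]
      rw [List.map_cons, List.prod_cons, foxGroup_mul, ih hl.2, mul_zero, add_zero]
      simp only [c, foxGroup_mul, foxGroup_inv, foxGroup_basis_of_ne b h1,
        foxGroup_basis_of_ne b h2, mul_zero, neg_zero, add_zero]
  -- The product is split at the `i`-th commutator, the only one that involves `α_i` or `β_i`.
  obtain ⟨s, t, hst⟩ := List.append_of_mem (List.mem_finRange i)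
  have hnd : (s ++ i :: t).Nodup := hst ▸ List.nodup_finRange g
  have hs : i ∉ s := fun h => (List.nodup_append.1 hnd).2.2 i h i (List.mem_cons_self) rfl
  have ht : i ∉ t := (List.nodup_cons.1 (List.nodup_append.1 hnd).2.1).1
  have hr : surfaceRelator b = (s.map c).prod * (c i * (t.map c).prod) := by
    rw [surfaceRelator, List.ofFn_eq_map, hst, List.map_append, List.prod_append, List.map_cons,
      List.prod_cons]
  have hd : ∀ x : Fin g ⊕ Fin g, x = Sum.inl i ∨ x = Sum.inr i →
      foxGroup b x (surfaceRelator b) =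
        MonoidAlgebra.of ℤ G (s.map c).prod * foxGroup b x (c i) := by
    intro x hx
    rw [hr, foxGroup_mul, foxGroup_mul, hzero x hx s hs, hzero x hx t ht, mul_zero, add_zero,
      zero_add]
  -- `u` is the product of the commutators before the `i`-th, and `v` includes the `i`-th as well.
  refine ⟨(s.map c).prod, (s.map c).prod * c i, hprod s, p.ker.mul_mem (hprod s) (hc i), ?_, ?_⟩
  · rw [hd _ (Or.inl rfl)]
    simp only [c, foxGroup_mul, foxGroup_inv, foxGroup_basis_self,
      foxGroup_basis_of_ne b (Sum.inr_ne_inl (a := i) (b := i)), mul_zero, neg_zero,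
      zero_add, mul_one, map_mul, mul_add, mul_neg, mul_assoc]
    abel
  · rw [hd _ (Or.inr rfl)]
    simp only [c, foxGroup_mul, foxGroup_inv, foxGroup_basis_self,
      foxGroup_basis_of_ne b (Sum.inl_ne_inr (a := i) (b := i)), mul_zero, neg_zero, add_zero,
      zero_add, mul_one, map_mul, mul_add, mul_neg, mul_assoc]
    abel

theorem augmentation_foxGroup_surfaceRelator (hp : ∀ i, p (b (Sum.inl i)) = 1)
    (j : Fin g ⊕ Fin g) : augmentation (foxGroup b j (surfaceRelator b)) = 0 := by
  rcases j with i | i <;> obtain ⟨u, v, -, -, h1, h2⟩ := foxGroup_surfaceRelator b p hp i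
  · rw [h1, map_sub, augmentation_of, augmentation_of, sub_self]
  · rw [h2, map_sub, augmentation_of, augmentation_of, sub_self]

/-- Three blocks become constant because the factors `u`, `v` and `α_i` of the first derivatives die
in `F`, and their conjugate derivatives along parallels vanish. The fourth block is left as an
unknown `A`. -/
theorem foxHessian_surfaceRelator
    (hp : p.ker = Subgroup.normalClosure (Set.range fun i => b (Sum.inl i))) :
    ∃ A : Matrix (Fin g) (Fin g) (MonoidAlgebra ℤ F),
      foxHessian b p (surfaceRelator b) = Matrix.fromBlocks A (-1) 1 0 := by
  have hα : ∀ i, p (b (Sum.inl i)) = 1 := fun i => by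
    have : b (Sum.inl i) ∈ p.ker := hp ▸ Subgroup.subset_normalClosure ⟨i, rfl⟩
    exact this
  refine ⟨(foxHessian b p (surfaceRelator b)).toBlocks₁₁, ?_⟩
  refine Matrix.ext_iff_blocks.2 ⟨rfl, ?_, ?_, ?_⟩
  · rw [Matrix.toBlocks_fromBlocks₁₂]
    ext1 k i
    obtain ⟨u, v, hu, -, -, h⟩ := foxGroup_surfaceRelator b p hα i
    simp only [Matrix.toBlocks₁₂, foxHessian, Matrix.of_apply]
    -- As `p α_i = 1`, the two terms in `u β_i⁻¹` cancel. What remains is the conjugate derivative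
    -- of `α_i`, hence the sign: it differentiates `α_i⁻¹`.
    rw [h, map_sub, coFox_of_mul_of, map_sub, map_add, map_mul, mapDomainRingHom_of, hα, map_one,
      mul_one, add_sub_cancel_left, coFox_of, foxGroup_inv, foxGroup_basis, mapDomainRingHom_bar,
      map_neg, map_mul, mapDomainRingHom_of, map_inv, hα, inv_one, map_one, one_mul,
      ← barHom_apply, map_neg, barHom_apply, Matrix.neg_apply, Matrix.one_apply]
    by_cases hki : k = i
    · rw [if_pos (congrArg Sum.inl hki.symm), if_pos hki, map_one, bar_one]
    · rw [if_neg fun h => hki (Sum.inl_injective h).symm, if_neg hki, map_zero, bar_zero]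
  · rw [Matrix.toBlocks_fromBlocks₂₁]
    ext1 k i
    obtain ⟨u, v, hu, hv, h, -⟩ := foxGroup_surfaceRelator b p hα i
    simp only [Matrix.toBlocks₂₁, foxHessian, Matrix.of_apply]
    rw [h, map_sub, coFox_of_mul_of, map_sub, map_add, map_mul, coFox_inr_of_mem_ker b p hp k hu,
      coFox_inr_of_mem_ker b p hp k hv, zero_mul, zero_add, sub_zero, coFox_of, inv_inv,
      foxGroup_basis, Matrix.one_apply, mapDomainRingHom_bar]
    by_cases hki : k = i
    · rw [if_pos (congrArg Sum.inr hki.symm), if_pos hki, map_one, bar_one]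
    · rw [if_neg fun h => hki (Sum.inr_injective h).symm, if_neg hki, map_zero, bar_zero]
  · rw [Matrix.toBlocks_fromBlocks₂₂]
    ext1 k i
    obtain ⟨u, v, hu, -, -, h⟩ := foxGroup_surfaceRelator b p hα i
    simp only [Matrix.toBlocks₂₂, foxHessian, Matrix.of_apply]
    rw [h, map_sub, coFox_of_mul_of, map_sub, map_add, map_mul, mapDomainRingHom_of, hα, map_one,
      mul_one, add_sub_cancel_left,
      coFox_inr_of_mem_ker b p hp k (show b (Sum.inl i) ∈ p.ker from hα i), Matrix.zero_apply]

/-! ### Block form of the Jacobian. -/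

theorem foxJacobian_toBlocks₂₁
    (hp : p.ker = Subgroup.normalClosure (Set.range fun i => b (Sum.inl i)))
    {φ : G →* G} {ψ : F →* F} (h : ∀ u, p (φ u) = ψ (p u)) :
    (foxJacobian b p φ).toBlocks₂₁ = 0 := by
  ext1 k l
  simp only [Matrix.toBlocks₂₁, foxJacobian, Matrix.of_apply, Matrix.zero_apply]
  have hl : b (Sum.inl l) ∈ p.ker := hp ▸ Subgroup.subset_normalClosure ⟨l, rfl⟩
  have hφ : φ (b (Sum.inl l)) ∈ p.ker := by
    rw [MonoidHom.mem_ker, h, MonoidHom.mem_ker.1 hl, map_one]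
  rw [mapDomainRingHom_bar, foxGroup_inr_of_mem_ker b p hp k hφ, bar_zero]

theorem foxJacobian_toBlocks₂₂_of_comp_eq
    (hp : p.ker = Subgroup.normalClosure (Set.range fun i => b (Sum.inl i)))
    {φ : G →* G} (h : ∀ u, p (φ u) = p u) :
    (foxJacobian b p φ).toBlocks₂₂ = 1 := by
  ext1 k l
  simp only [Matrix.toBlocks₂₂, foxJacobian, Matrix.of_apply]
  have hn : (b (Sum.inr l))⁻¹ * φ (b (Sum.inr l)) ∈ p.ker := by
    rw [MonoidHom.mem_ker, map_mul, map_inv, h, inv_mul_cancel]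
  -- `φ` moves `β_l` only by a factor in `ker p`, to which derivatives along parallels are blind.
  have hβ : φ (b (Sum.inr l)) = b (Sum.inr l) * ((b (Sum.inr l))⁻¹ * φ (b (Sum.inr l))) := by
    rw [mul_inv_cancel_left]
  rw [hβ, mapDomainRingHom_bar, foxGroup_mul, map_add, map_mul,
    foxGroup_inr_of_mem_ker b p hp k hn, mul_zero, add_zero, foxGroup_basis, Matrix.one_apply]
  by_cases hkl : k = l
  · rw [if_pos (congrArg Sum.inr hkl.symm), if_pos hkl, map_one, bar_one]
  · rw [if_neg fun h => hkl (Sum.inr_injective h).symm, if_neg hkl, map_zero, bar_zero]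

theorem dagger_fromBlocks (A B C D : Matrix (Fin g) (Fin g) (MonoidAlgebra ℤ F)) :
    dagger (Matrix.fromBlocks A B C D) =
      Matrix.fromBlocks (dagger A) (dagger C) (dagger B) (dagger D) := by
  ext1 i j
  rcases i with i | i <;> rcases j with j | j <;> rfl

theorem dagger_zero : dagger (0 : Matrix (Fin g) (Fin g) (MonoidAlgebra ℤ F)) = 0 := by
  ext1 i j
  exact bar_zero

theorem dagger_one : dagger (1 : Matrix (Fin g) (Fin g) (MonoidAlgebra ℤ F)) = 1 := by
  ext1 i j
  simp only [dagger, Matrix.of_apply, Matrix.one_apply, eq_comm (a := j)]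
  split_ifs
  · exact bar_one
  · exact bar_zero

theorem dagger_dagger (A : Matrix (Fin g) (Fin g) (MonoidAlgebra ℤ F)) :
    dagger (dagger A) = A := by
  ext1 i j
  exact bar_bar _

/-! ### Consequences of the invariance of the relator. -/

variable {b p}

/-- The two left-hand block relations of the symplecticity of the Jacobian matrix. -/
theorem foxJacobian_blocks
    (hp : p.ker = Subgroup.normalClosure (Set.range fun i => b (Sum.inl i)))
    {φ : G →* G} {ψ : F →* F} (h : ∀ u, p (φ u) = ψ (p u))
    (hφ : φ (surfaceRelator b) = surfaceRelator b) :
    (foxJacobian b p φ).toBlocks₂₂ * dagger (foxJacobian b p φ).toBlocks₁₁ = 1 ∧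
    ∃ A : Matrix (Fin g) (Fin g) (MonoidAlgebra ℤ F),
      A = ((foxJacobian b p φ).toBlocks₁₁ * A.map (MonoidAlgebra.mapDomainRingHom ℤ ψ) +
          (foxJacobian b p φ).toBlocks₁₂) * dagger (foxJacobian b p φ).toBlocks₁₁ -
        (foxJacobian b p φ).toBlocks₁₁ * dagger (foxJacobian b p φ).toBlocks₁₂ := by
  have hα : ∀ i, p (b (Sum.inl i)) = 1 := fun i => by
    have : b (Sum.inl i) ∈ p.ker := hp ▸ Subgroup.subset_normalClosure ⟨i, rfl⟩
    exact this
  have hs := foxHessian_eq b p φ ψ h hφ (augmentation_foxGroup_surfaceRelator b p hα)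
  obtain ⟨A, hA⟩ := foxHessian_surfaceRelator b p hp
  have hJ := (Matrix.fromBlocks_toBlocks (foxJacobian b p φ)).symm
  rw [foxJacobian_toBlocks₂₁ b p hp h] at hJ
  rw [hA, hJ, dagger_fromBlocks, Matrix.fromBlocks_map, Matrix.fromBlocks_multiply,
    Matrix.fromBlocks_multiply, Matrix.fromBlocks_inj] at hs
  have hneg : (-1 : Matrix (Fin g) (Fin g) (MonoidAlgebra ℤ F)).map
      (MonoidAlgebra.mapDomainRingHom ℤ ψ) = -1 := by
    rw [Matrix.map_neg _ (map_neg _), Matrix.map_one _ (map_zero _) (map_one _)]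
  simp only [Matrix.map_one _ (map_zero _) (map_one _), Matrix.map_zero _ (map_zero _), hneg,
    mul_one, mul_zero, zero_mul, add_zero, zero_add, dagger_zero, mul_neg, neg_mul, neg_zero]
    at hs
  -- Only the lower-left and upper-left blocks of the invariance relation are used.
  exact ⟨hs.2.2.1.symm, A, by rw [sub_eq_add_neg]; exact hs.1⟩

/-- Here `ψ` is the identity and the lower-right block is `1`, so the first relation of
`foxJacobian_blocks` forces the upper-left block to be `1` and the second loses `A`. -/
theorem foxJacobian_unipotent
    (hp : p.ker = Subgroup.normalClosure (Set.range fun i => b (Sum.inl i)))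
    {φ : G →* G} (h : ∀ u, p (φ u) = p u) (hφ : φ (surfaceRelator b) = surfaceRelator b) :
    foxJacobian b p φ = Matrix.fromBlocks 1 (foxJacobian b p φ).toBlocks₁₂ 0 1 ∧
      (foxJacobian b p φ).toBlocks₁₂ = dagger (foxJacobian b p φ).toBlocks₁₂ := by
  have h' : ∀ u, p (φ u) = MonoidHom.id F (p u) := h
  obtain ⟨h22, A, hA⟩ := foxJacobian_blocks hp h' hφ
  rw [foxJacobian_toBlocks₂₂_of_comp_eq b p hp h, one_mul] at h22
  have h11 : (foxJacobian b p φ).toBlocks₁₁ = 1 := by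
    rw [← dagger_dagger (foxJacobian b p φ).toBlocks₁₁, h22, dagger_one]
  rw [h22, h11, one_mul, one_mul, mul_one, MonoidAlgebra.mapDomainRingHom_id] at hA
  refine ⟨?_, ?_⟩
  · conv_lhs => rw [← Matrix.fromBlocks_toBlocks (foxJacobian b p φ)]
    rw [h11, foxJacobian_toBlocks₂₂_of_comp_eq b p hp h, foxJacobian_toBlocks₂₁ b p hp h']
  · change A = A + _ - _ at hA
    rw [add_sub_assoc, left_eq_add, sub_eq_zero] at hA
    exact hA

theorem foxJacobian_conj
    (hp : p.ker = Subgroup.normalClosure (Set.range fun i => b (Sum.inl i)))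
    {φ χ χ' : G →* G} {ψ : F →* F} (h : ∀ u, p (φ u) = ψ (p u)) (hχ : ∀ u, p (χ u) = p u)
    (hχ' : ∀ u, p (χ' u) = p u) (hφ : φ (surfaceRelator b) = surfaceRelator b)
    (hχw : χ (surfaceRelator b) = surfaceRelator b)
    (hχw' : χ' (surfaceRelator b) = surfaceRelator b) (hc : χ'.comp φ = φ.comp χ) :
    (foxJacobian b p χ').toBlocks₁₂ =
      (foxJacobian b p φ).toBlocks₁₁ *
        (foxJacobian b p χ).toBlocks₁₂.map (MonoidAlgebra.mapDomainRingHom ℤ ψ) *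
        dagger (foxJacobian b p φ).toBlocks₁₁ := by
  have hJ : foxJacobian b p χ' * foxJacobian b p φ =
      foxJacobian b p φ * (foxJacobian b p χ).map (MonoidAlgebra.mapDomainRingHom ℤ ψ) := by
    rw [← foxJacobian_comp b p φ χ ψ h, ← hc,
      foxJacobian_comp b p χ' φ (MonoidHom.id F) hχ', MonoidAlgebra.mapDomainRingHom_id]
    rfl
  have hφJ := (Matrix.fromBlocks_toBlocks (foxJacobian b p φ)).symm
  rw [foxJacobian_toBlocks₂₁ b p hp h] at hφJ
  rw [(foxJacobian_unipotent hp hχ hχw).1, (foxJacobian_unipotent hp hχ' hχw').1, hφJ,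
    Matrix.fromBlocks_map, Matrix.fromBlocks_multiply, Matrix.fromBlocks_multiply,
    Matrix.fromBlocks_inj] at hJ
  have h12 := hJ.2.1
  rw [one_mul, Matrix.map_one _ (map_zero _) (map_one _), mul_one, add_comm,
    add_left_inj] at h12
  -- The conjugate transpose of the upper-left block is a right inverse of the lower-right one.
  rw [← h12, mul_assoc, (foxJacobian_blocks hp h hφ).1, mul_one]

end MeridianBasis

/-! ### The action of the handlebody group -/

namespace BoundaryDisk

variable {V : Type*} [TopologicalSpace V] (D : BoundaryDisk V)

/-- The boundary loop runs in `D`, which a representative fixes pointwise, so the loop itself is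
unchanged and no homotopy is needed. -/
theorem surfaceAction_zeta (h : D.HandlebodyGroup) : D.surfaceAction h D.zeta = D.zeta := by
  obtain ⟨k, rfl⟩ := QuotientGroup.mk_surjective h
  change basedHomeoEnd D.base (D.restrictSurface k) (Pi1.mk D.boundaryLoop) = _
  rw [basedHomeoEnd_mk]
  refine congrArg Pi1.mk (Path.ext (funext fun t => Subtype.ext ?_))
  exact k.2 _

theorem proj_surfaceAction (h : D.HandlebodyGroup) (a : D.surfaceGroup) :
    D.proj (D.surfaceAction h a) = D.bodyAction h (D.proj a) := by
  obtain ⟨k, rfl⟩ := QuotientGroup.mk_surjective h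
  obtain ⟨q, rfl⟩ := Pi1.mk_surjective a
  change D.proj (basedHomeoEnd D.base (D.restrictSurface k) (Pi1.mk q)) =
    basedHomeoEnd (D.base : V) (D.relHomeoToBased k) (D.proj (Pi1.mk q))
  rw [basedHomeoEnd_mk, proj, Pi1.map_mk, Pi1.map_mk, basedHomeoEnd_mk]
  rfl

theorem proj_surfaceAction_of_mem_twistGroup {f : D.HandlebodyGroup} (hf : f ∈ D.twistGroup)
    (a : D.surfaceGroup) : D.proj (D.surfaceAction f a) = D.proj a := by
  rw [proj_surfaceAction, show D.bodyAction f = 1 from hf]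
  rfl

namespace CurveSystem

variable {D} {g : ℕ} (B : D.CurveSystem g)

theorem jacobianF_eq (h : D.HandlebodyGroup) :
    B.jacobianF h = foxJacobian B.basis D.proj (D.surfaceAction h).toMonoidHom := by
  ext1 k l
  simp only [jacobianF, foxJacobian, Matrix.of_apply, foxDeriv_of]
  rfl

theorem surfaceAction_surfaceRelator (h : D.HandlebodyGroup) :
    (D.surfaceAction h).toMonoidHom (surfaceRelator B.basis) = surfaceRelator B.basis := by
  have hz : surfaceRelator B.basis = D.zeta⁻¹ := B.zeta_inv.symm
  rw [hz, map_inv]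
  exact congrArg (·⁻¹) (D.surfaceAction_zeta h)

end CurveSystem

end BoundaryDisk

theorem proposition6p3 (g : ℕ) {V : Type*} [TopologicalSpace V] (hV : IsHandlebody g V)
    (D : BoundaryDisk V) (B : D.CurveSystem g) :
    (∀ f : D.twistGroup, B.mag f = dagger (B.mag f)) ∧
    (∀ (f : D.twistGroup) (h : D.HandlebodyGroup),
      B.mag ⟨h * f.1 * h⁻¹, D.twistGroup_normal.conj_mem f.1 f.2 h⟩ =
        B.magAlpha h *
          (B.mag f).map (MonoidAlgebra.mapDomainRingHom ℤ (D.bodyAction h).toMonoidHom) *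
          dagger (B.magAlpha h)) := by
  refine ⟨fun f => ?_, fun f h => ?_⟩
  · rw [BoundaryDisk.CurveSystem.mag, B.jacobianF_eq]
    exact (foxJacobian_unipotent B.ker_proj (D.proj_surfaceAction_of_mem_twistGroup f.2)
      (B.surfaceAction_surfaceRelator f.1)).2
  · rw [BoundaryDisk.CurveSystem.mag, BoundaryDisk.CurveSystem.mag,
      BoundaryDisk.CurveSystem.magAlpha, B.jacobianF_eq, B.jacobianF_eq, B.jacobianF_eq]
    refine foxJacobian_conj B.ker_proj (D.proj_surfaceAction h)
      (D.proj_surfaceAction_of_mem_twistGroup f.2)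
      (D.proj_surfaceAction_of_mem_twistGroup (D.twistGroup_normal.conj_mem f.1 f.2 h))
      (B.surfaceAction_surfaceRelator h) (B.surfaceAction_surfaceRelator f.1)
      (B.surfaceAction_surfaceRelator _) (MonoidHom.ext fun a => ?_)
    -- Using `(hfh⁻¹)h = hf` avoids computing a Jacobian of `h⁻¹`.
    change (D.surfaceAction (h * f.1 * h⁻¹) * D.surfaceAction h) a =
      (D.surfaceAction h * D.surfaceAction f.1) a
    rw [← map_mul, ← map_mul, inv_mul_cancel_right]
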